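/- Let $m\in\{2,3\}$, $N\ge 0$ and $n=N+3$. Agents $1,\dots,n$ have positions $p_i\in\mathbb{R}^m$ and velocities $v_i\in\mathbb{R}^m$. Consider the graph with the $2N+3$ ordered edges (tail, head) $$\mathcal E_1=(2,1),\quad \mathcal E_2=(2,3),\quad \mathcal E_3=(3,1),\quad\text{and, for every new agent } i=4,\dots,n,\quad (2,i)\ \text{and}\ (3,i).$$ The tail of an edge is its estimating agent. Let $B=(b_{ik})$ be the incidence matrix ($b_{ik}=1$ if $i$ is the tail of edge $k$, $b_{ik}=-1$ if $i$ is its head, $b_{ik}=0$ otherwise), let $S_1$ be $B$ with its entries $-1$ replaced by $0$, and write $\overline A=A\otimes I_m$. For positions $p$ put $z=\overline B^{T}p$ (so $z_k=p_{\mathrm{tail}}-p_{\mathrm{head}}$) and let $D_z$ be the block diagonal matrix of the $z_k$. Let $p^*$ be a desired configuration such that the framework is infinitesimally and minimally rigid: the rigidity matrix $D_{z^*}^T\overline B^T$, $z^*=\overline B^Tp^*$, has rank $2n-3$ and the number of edges is $2n-3$ if $m=2$; with $3n-6$ in place of $2n-3$ if $m=3$. Put $d_k=\|z_k^*\|$ and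 $e_k=\|z_k\|^2-d_k^2$. For constant mismatches $\mu$ (one real number for each edge) consider the closed-loop system with estimator state $\hat\mu$, $$\dot p=v,\qquad \dot v=-v-\overline B D_z e-\overline S_1D_z(\mu-\hat\mu),\qquad \dot{\hat\mu}=-D_z^T\overline S_1^Tv .$$ Then there is $\rho_0>0$, depending only on $N$, $m$ and $p^*$, such that for all $0<\rho\le\rho_0$, all $\mu$, and every solution on $[0,\infty)$ whose initial state satisfies $$\|\mu-\hat\mu(0)\|^2+\|v(0)\|^2+\tfrac12\|e(0)\|^2\le\rho,$$ one has $$\lim_{t\to\infty}e_k(t)=0\quad\text{for every edge } k\neq 2,\qquad\text{and}\qquad |e_2(t)|\le\sqrt{2\rho}\quad\text{for all } t\ge 0 .$$ -/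

import Mathlib

open scoped BigOperators Topology

noncomputable section

namespace Formation

/-- A sensing graph with agents `V`, edges labelled by `E` and an ordering (tail, head) of the two
ends of each edge: no loops, and no two edges join the same pair of agents.
The tail of an edge is the agent that runs the estimator for that edge. -/
structure SensingGraph (V E : Type*) where
  tail : E → V
  head : E → V
  tail_ne_head : ∀ k, tail k ≠ head k
  edge_injective : Function.Injective fun k => s(tail k, head k)

namespace SensingGraph

variable {V E : Type*} [Fintype V] [DecidableEq V] [Fintype E] {m : ℕ}

/-- The incidence matrix `B`. -/
def incidence (G : SensingGraph V E) : Matrix V E ℝ :=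
  fun i k => if i = G.tail k then 1 else if i = G.head k then -1 else 0

/-- The matrix `S₁`: the incidence matrix with its `-1` entries replaced by `0`. -/
def estimating (G : SensingGraph V E) : Matrix V E ℝ :=
  fun i k => if i = G.tail k then 1 else 0

/-- Stacked relative positions `z = (B ⊗ I_m)ᵀ p`, i.e. `z_k = p_tail - p_head`. -/
def relPos (G : SensingGraph V E) (p : V → EuclideanSpace ℝ (Fin m)) (k : E) :
    EuclideanSpace ℝ (Fin m) :=
  ∑ i, G.incidence i k • p i

/-- The rigidity matrix `R = D_zᵀ (B ⊗ I_m)ᵀ`, half the Jacobian of `p ↦ (‖z_k‖²)_k`;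
its columns are indexed by the coordinates of the agents. -/
def rigidityMatrix (G : SensingGraph V E) (p : V → EuclideanSpace ℝ (Fin m)) :
    Matrix E (V × Fin m) ℝ :=
  fun k ia => G.relPos p k ia.2 * G.incidence ia.1 k

/-- Infinitesimal rigidity of the framework `(G, p)` in the plane (rank `2n - 3`) or in
three-dimensional space (rank `3n - 6`), `n` being the number of agents. -/
def IsInfinitesimallyRigid (G : SensingGraph V E) (p : V → EuclideanSpace ℝ (Fin m)) : Prop :=
  (m = 2 ∧ (G.rigidityMatrix p).rank + 3 = 2 * Fintype.card V) ∨
  (m = 3 ∧ (G.rigidityMatrix p).rank + 6 = 3 * Fintype.card V)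

/-- Infinitesimally and minimally rigid: moreover the number of edges is `2n - 3` in the plane,
`3n - 6` in space. -/
def IsInfinitesimallyMinimallyRigid (G : SensingGraph V E)
    (p : V → EuclideanSpace ℝ (Fin m)) : Prop :=
  G.IsInfinitesimallyRigid p ∧
  (m = 2 → Fintype.card E + 3 = 2 * Fintype.card V) ∧
  (m = 3 → Fintype.card E + 6 = 3 * Fintype.card V)

/-- The distance error `e_k = ‖z_k‖² - d_k²`, where `d_k = ‖z*_k‖` and `z*` are the relative
positions of the desired configuration `pstar`. -/
def distError (G : SensingGraph V E) (pstar p : V → EuclideanSpace ℝ (Fin m)) (k : E) : ℝ :=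
  ‖G.relPos p k‖ ^ 2 - ‖G.relPos pstar k‖ ^ 2

/-- The mismatched gradient control with estimator,
`u = -v - (B ⊗ I_m) D_z e - (S₁ ⊗ I_m) D_z (μ - μhat)`, at agent `i`. -/
def control (G : SensingGraph V E) (pstar : V → EuclideanSpace ℝ (Fin m)) (μ : E → ℝ)
    (p v : V → EuclideanSpace ℝ (Fin m)) (μhat : E → ℝ) (i : V) : EuclideanSpace ℝ (Fin m) :=
  - v i - (∑ k, (G.incidence i k * G.distError pstar p k) • G.relPos p k)
    - ∑ k, (G.estimating i k * (μ k - μhat k)) • G.relPos p k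

/-- The estimator input `uhat = - D_zᵀ (S₁ ⊗ I_m)ᵀ v`, at edge `k`. -/
def estimatorInput (G : SensingGraph V E) (p v : V → EuclideanSpace ℝ (Fin m)) (k : E) : ℝ :=
  - inner ℝ (G.relPos p k) (∑ i, G.estimating i k • v i)

/-- `(p, v, μhat)` is a solution on `[0, ∞)` of the closed loop `p' = v`, `v' = u`,
`μhat' = uhat` with desired configuration `pstar` and constant mismatches `μ`
(the derivative at time `0` is the one from the right). -/
structure IsTrajectory (G : SensingGraph V E) (pstar : V → EuclideanSpace ℝ (Fin m)) (μ : E → ℝ)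
    (p v : ℝ → V → EuclideanSpace ℝ (Fin m)) (μhat : ℝ → E → ℝ) : Prop where
  position : ∀ t, 0 ≤ t → ∀ i,
    HasDerivWithinAt (fun s => p s i) (v t i) (Set.Ici 0) t
  velocity : ∀ t, 0 ≤ t → ∀ i,
    HasDerivWithinAt (fun s => v s i) (G.control pstar μ (p t) (v t) (μhat t) i) (Set.Ici 0) t
  estimator : ∀ t, 0 ≤ t → ∀ k,
    HasDerivWithinAt (fun s => μhat s k) (G.estimatorInput (p t) (v t) k) (Set.Ici 0) t

/-- Membership of a state in the set `‖ξ‖² + ‖v‖² + ‖e‖² / 2 ≤ ρ`, where `ξ = μ - μhat`. -/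
def InSublevel (G : SensingGraph V E) (pstar : V → EuclideanSpace ℝ (Fin m)) (μ : E → ℝ)
    (ρ : ℝ) (p v : V → EuclideanSpace ℝ (Fin m)) (μhat : E → ℝ) : Prop :=
  ∑ k, (μ k - μhat k) ^ 2 + ∑ i, ‖v i‖ ^ 2 + (∑ k, G.distError pstar p k ^ 2) / 2 ≤ ρ

end SensingGraph

/-- The agents: `Sum.inl 0, Sum.inl 1, Sum.inl 2` are the agents 1, 2, 3 of the triangle and
`Sum.inr j` is the `j`-th of `N` newly added agents. -/
abbrev StarAgent (N : ℕ) := Fin 3 ⊕ Fin N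

/-- The edges: `Sum.inl 0, Sum.inl 1, Sum.inl 2` are the edges 1, 2, 3 of the triangle;
`Sum.inr (j, 0)` and `Sum.inr (j, 1)` link the `j`-th new agent to agents 2 and 3. -/
abbrev StarEdge (N : ℕ) := Fin 3 ⊕ (Fin N × Fin 2)

/-- The estimating agents: edges 1 and 2 of the triangle have tail 2, edge 3 has tail 3;
the two new links at each new agent have tails 2 and 3. -/
def starTail (N : ℕ) : StarEdge N → StarAgent N
  | Sum.inl k => Sum.inl (![1, 1, 2] k)
  | Sum.inr (_, a) => Sum.inl (![1, 2] a)

/-- The other ends: edges 1, 2, 3 of the triangle have heads 1, 3, 1;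
the two new links at a new agent have that agent as head. -/
def starHead (N : ℕ) : StarEdge N → StarAgent N
  | Sum.inl k => Sum.inl (![0, 2, 0] k)
  | Sum.inr (j, _) => Sum.inr j

/-- The triangle with acyclic estimating agents and `N` further agents, each linked to agents
2 and 3 only. -/
def starGraph (N : ℕ) : SensingGraph (StarAgent N) (StarEdge N) where
  tail := starTail N
  head := starHead N
  tail_ne_head := by
    rintro (k | ⟨j, a⟩)
    · fin_cases k <;> simp [starTail, starHead]
    · simp [starTail, starHead]
  edge_injective := by
    rintro (k | ⟨j, a⟩) (l | ⟨i, b⟩) h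
    · fin_cases k <;> fin_cases l <;> simp [starTail, starHead] at h ⊢
    · simp [starTail, starHead] at h
    · simp [starTail, starHead] at h
    · fin_cases a <;> fin_cases b <;> simp_all [starTail, starHead]

end Formation

end

/-! The energy `‖μ - μhat‖² + ‖v‖² + ‖e‖²/2` decreases at rate `2‖v‖²`: the distance-error forces
exchange energy with `e`, the mismatch forces with the estimator, and only damping is left. Hence
errors never exceed `√(2ρ)`, which is already the claim for edge 2, and relative positions,
velocities and estimation errors stay bounded. Positions need not, so convergence comes from
Barbalat's lemma: applied to the energy it gives `v → 0`, applied to `v` it gives `v' → 0`.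

The graph is a family of triangles on the common base 2–3. Their apexes (agent 1 and the new agents)
estimate nothing, so at an apex the limit says only that `e_l z_l + e_r z_r → 0` for its two legs
(`tendsto_force`). Rigidity makes the desired legs independent (`legs_independent`). Their Gram
determinant depends only on the three side lengths, so on the errors, and small errors keep it away
from zero (`exists_legGram_lower_bound`). Thus both coefficients tend to zero
(`tendsto_coeff_zero`). Every edge except the base is a leg. -/

noncomputable section

namespace Formation

open Set Filter

/-! ### Bounded and Lipschitz signals; Barbalat's lemma. -/

section Signals

variable {F : Type*} [NormedAddCommGroup F]

/-- Boundedness of a signal on `[0, ∞)`. -/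
def BoundedSignal (f : ℝ → F) : Prop := ∃ C, ∀ t, 0 ≤ t → ‖f t‖ ≤ C

/-- Signals that are bounded and Lipschitz on `[0, ∞)`. -/
def TameSignal (f : ℝ → F) : Prop :=
  BoundedSignal f ∧ ∃ K, ∀ s t, 0 ≤ s → 0 ≤ t → ‖f s - f t‖ ≤ K * |s - t|

namespace BoundedSignal

theorem const (c : F) : BoundedSignal fun _ => c := ⟨‖c‖, fun _ _ => le_rfl⟩

theorem add {f g : ℝ → F} (hf : BoundedSignal f) (hg : BoundedSignal g) :
    BoundedSignal fun t => f t + g t := by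
  obtain ⟨C, hC⟩ := hf
  obtain ⟨D, hD⟩ := hg
  exact ⟨C + D, fun t ht => (norm_add_le _ _).trans (add_le_add (hC t ht) (hD t ht))⟩

theorem neg {f : ℝ → F} (hf : BoundedSignal f) : BoundedSignal fun t => -f t := by
  simpa [BoundedSignal] using hf

theorem sub {f g : ℝ → F} (hf : BoundedSignal f) (hg : BoundedSignal g) :
    BoundedSignal fun t => f t - g t := by
  simpa only [sub_eq_add_neg] using hf.add hg.neg

theorem sum {ι : Type*} (s : Finset ι) {f : ι → ℝ → F} (hf : ∀ i, BoundedSignal (f i)) :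
    BoundedSignal fun t => ∑ i ∈ s, f i t := by
  choose C hC using hf
  exact ⟨∑ i ∈ s, C i, fun t ht => norm_sum_le_of_le _ fun i _ => hC i t ht⟩

theorem smul [NormedSpace ℝ F] {a : ℝ → ℝ} {f : ℝ → F} (ha : BoundedSignal a) (hf : BoundedSignal f) :
    BoundedSignal fun t => a t • f t := by
  obtain ⟨C, hC⟩ := ha
  obtain ⟨D, hD⟩ := hf
  refine ⟨C * D, fun t ht => ?_⟩
  rw [norm_smul]
  exact mul_le_mul (hC t ht) (hD t ht) (norm_nonneg _) ((norm_nonneg _).trans (hC t ht))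

theorem inner {F : Type*} [NormedAddCommGroup F] [InnerProductSpace ℝ F] {f g : ℝ → F}
    (hf : BoundedSignal f) (hg : BoundedSignal g) :
    BoundedSignal fun t => Inner.inner ℝ (f t) (g t) := by
  obtain ⟨C, hC⟩ := hf
  obtain ⟨D, hD⟩ := hg
  exact ⟨C * D, fun t ht => (norm_inner_le_norm _ _).trans
    (mul_le_mul (hC t ht) (hD t ht) (norm_nonneg _) ((norm_nonneg _).trans (hC t ht)))⟩

/-- A bounded signal with bounded derivative is tame. -/
theorem tame [NormedSpace ℝ F] {f f' : ℝ → F} (hf : BoundedSignal f) (hf' : BoundedSignal f')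
    (hd : ∀ t, 0 ≤ t → HasDerivWithinAt f (f' t) (Ici 0) t) : TameSignal f := by
  obtain ⟨C, hC⟩ := hf'
  exact ⟨hf, C, fun s t hs ht =>
    (convex_Ici (0 : ℝ)).norm_image_sub_le_of_norm_hasDerivWithin_le hd hC ht hs⟩

end BoundedSignal

namespace TameSignal

theorem const (c : F) : TameSignal fun _ => c := ⟨.const c, 0, by simp⟩

theorem add {f g : ℝ → F} (hf : TameSignal f) (hg : TameSignal g) :
    TameSignal fun t => f t + g t := by
  obtain ⟨hf, K, hK⟩ := hf
  obtain ⟨hg, L, hL⟩ := hg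
  refine ⟨hf.add hg, K + L, fun s t hs ht => ?_⟩
  rw [add_sub_add_comm, add_mul]
  exact (norm_add_le _ _).trans (add_le_add (hK s t hs ht) (hL s t hs ht))

theorem neg {f : ℝ → F} (hf : TameSignal f) : TameSignal fun t => -f t := by
  obtain ⟨hf, K, hK⟩ := hf
  refine ⟨hf.neg, K, fun s t hs ht => ?_⟩
  rw [← neg_sub', norm_neg]
  exact hK s t hs ht

theorem sub {f g : ℝ → F} (hf : TameSignal f) (hg : TameSignal g) :
    TameSignal fun t => f t - g t := by
  simpa only [sub_eq_add_neg] using hf.add hg.neg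

theorem sum {ι : Type*} (s : Finset ι) {f : ι → ℝ → F} (hf : ∀ i, TameSignal (f i)) :
    TameSignal fun t => ∑ i ∈ s, f i t := by
  choose hb K hK using hf
  refine ⟨.sum s hb, ∑ i ∈ s, K i, fun t u ht hu => ?_⟩
  rw [← Finset.sum_sub_distrib, Finset.sum_mul]
  exact norm_sum_le_of_le _ fun i _ => hK i t u ht hu

theorem smul [NormedSpace ℝ F] {a : ℝ → ℝ} {f : ℝ → F} (ha : TameSignal a) (hf : TameSignal f) :
    TameSignal fun t => a t • f t := by
  obtain ⟨ha, K, hK⟩ := ha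
  obtain ⟨hf, L, hL⟩ := hf
  refine ⟨ha.smul hf, ?_⟩
  obtain ⟨C, hC⟩ := ha
  obtain ⟨D, hD⟩ := hf
  refine ⟨C * L + K * D, fun s t hs ht => ?_⟩
  have h : a s • f s - a t • f t = a s • (f s - f t) + (a s - a t) • f t := by module
  calc ‖a s • f s - a t • f t‖ ≤ ‖a s‖ * ‖f s - f t‖ + ‖a s - a t‖ * ‖f t‖ := by
        rw [h, ← norm_smul, ← norm_smul]
        exact norm_add_le _ _
    _ ≤ C * (L * |s - t|) + (K * |s - t|) * D := by
        have hC0 : 0 ≤ C := (norm_nonneg _).trans (hC s hs)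
        have hK0 : 0 ≤ K * |s - t| := (norm_nonneg _).trans (hK s t hs ht)
        gcongr
        exacts [hC s hs, hL s t hs ht, hK s t hs ht, hD t ht]
    _ = _ := by ring

theorem norm_sq {F : Type*} [NormedAddCommGroup F] [InnerProductSpace ℝ F] {f : ℝ → F}
    (hf : TameSignal f) : TameSignal fun t => ‖f t‖ ^ 2 := by
  obtain ⟨⟨C, hC⟩, K, hK⟩ := hf
  refine ⟨⟨C ^ 2, fun t ht => ?_⟩, K * (C + C), fun s t hs ht => ?_⟩
  · rw [norm_pow, norm_norm]
    exact pow_le_pow_left₀ (norm_nonneg _) (hC t ht) 2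
  · rw [sq_sub_sq, norm_mul, mul_comm]
    have h1 : ‖‖f s‖ - ‖f t‖‖ ≤ K * |s - t| := (abs_norm_sub_norm_le _ _).trans (hK s t hs ht)
    have h2 : ‖‖f s‖ + ‖f t‖‖ ≤ C + C := by
      rw [Real.norm_of_nonneg (by positivity)]
      exact add_le_add (hC s hs) (hC t ht)
    calc _ ≤ (K * |s - t|) * (C + C) :=
          mul_le_mul h1 h2 (norm_nonneg _) ((norm_nonneg _).trans h1)
      _ = _ := by ring

end TameSignal

/-- Barbalat's lemma for signals with a Lipschitz derivative. -/
theorem tendsto_deriv_zero_of_tendsto [NormedSpace ℝ F] {f f' : ℝ → F} {L : F}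
    (hd : ∀ t, 0 ≤ t → HasDerivWithinAt f (f' t) (Ici 0) t) (hf' : TameSignal f')
    (hL : Tendsto f atTop (𝓝 L)) : Tendsto f' atTop (𝓝 0) := by
  obtain ⟨-, K, hK⟩ := hf'
  -- Mean value inequality for `s ↦ f s - s • f' t` on `[t, t + h]`, whose derivative is at most
  -- `|K| * h`.
  have hstep : ∀ h t, 0 < h → 0 ≤ t → ‖f' t‖ ≤ ‖f (t + h) - f t‖ / h + |K| * h := by
    intro h t hh ht
    have key : ‖(f (t + h) - (t + h) • f' t) - (f t - t • f' t)‖ ≤ |K| * h * ‖t + h - t‖ := by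
      refine (convex_Icc t (t + h)).norm_image_sub_le_of_norm_hasDerivWithin_le
        (f := fun s => f s - s • f' t) (f' := fun s => f' s - f' t) ?_ ?_
        (left_mem_Icc.2 (by linarith)) (right_mem_Icc.2 (by linarith))
      · intro s hs
        have h1 := (hd s (ht.trans hs.1)).mono (fun x hx => ht.trans hx.1 : Icc t (t + h) ⊆ Ici 0)
        have h2 := (hasDerivWithinAt_id s (Icc t (t + h))).smul_const (f' t)
        simpa using h1.fun_sub h2
      · intro s hs
        refine (hK s t (ht.trans hs.1) ht).trans ?_
        rw [abs_of_nonneg (sub_nonneg.2 hs.1)]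
        have := hs.2
        exact mul_le_mul (le_abs_self K) (by linarith) (sub_nonneg.2 hs.1) (abs_nonneg K)
    have e : (f (t + h) - (t + h) • f' t) - (f t - t • f' t)
        = (f (t + h) - f t) - h • f' t := by module
    rw [e, add_sub_cancel_left, Real.norm_of_nonneg hh.le] at key
    have h3 : h * ‖f' t‖ ≤ ‖f (t + h) - f t‖ + |K| * h * h := by
      have h4 : ‖h • f' t‖ = h * ‖f' t‖ := by rw [norm_smul, Real.norm_of_nonneg hh.le]
      have h5 := norm_sub_norm_le (h • f' t) (f (t + h) - f t)
      rw [norm_sub_rev (h • f' t)] at h5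
      linarith
    rw [← mul_le_mul_iff_right₀ hh]
    calc h * ‖f' t‖ ≤ _ := h3
      _ = _ := by field_simp
  rw [tendsto_zero_iff_norm_tendsto_zero, Metric.tendsto_atTop]
  intro ε hε
  -- This makes the Lipschitz term at most `ε / 2`; the `+ 1` covers `K = 0`.
  set h := ε / (2 * (|K| + 1)) with hh
  have hpos : 0 < h := by positivity
  have hlim : Tendsto (fun t => ‖f (t + h) - f t‖ / h) atTop (𝓝 0) := by
    have := ((hL.comp (tendsto_atTop_add_const_right _ h tendsto_id)).sub hL).norm.div_const h
    simpa using this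
  obtain ⟨T, hT⟩ := eventually_atTop.1
    ((hlim.eventually (gt_mem_nhds (half_pos hε))).and (eventually_ge_atTop 0))
  refine ⟨T, fun t ht => ?_⟩
  obtain ⟨h1, h2⟩ := hT t ht
  have h3 := hstep h t hpos h2
  have h4 : |K| * h ≤ ε / 2 := by
    rw [hh, mul_div_assoc', div_le_div_iff₀ (by positivity) two_pos]
    nlinarith [abs_nonneg K]
  rw [dist_zero_right, norm_norm]
  linarith

end Signals

/-! ### Energy dissipation and asymptotics for a general sensing graph. -/

namespace SensingGraph

variable {V E : Type*} [Fintype V] [DecidableEq V] {m : ℕ}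

theorem relPos_eq_sub (G : SensingGraph V E) (p : V → EuclideanSpace ℝ (Fin m)) (k : E) :
    G.relPos p k = p (G.tail k) - p (G.head k) := by
  have h : ∀ i, G.incidence i k • p i
      = (if i = G.tail k then p i else 0) - (if i = G.head k then p i else 0) := by
    intro i
    have := G.tail_ne_head k
    unfold incidence
    split_ifs <;> simp_all
  simp [relPos, h, Finset.sum_sub_distrib]

variable [Fintype E]

/-- The energy of the closed loop: the function whose sublevel sets are `InSublevel`. -/
def energy (G : SensingGraph V E) (pstar : V → EuclideanSpace ℝ (Fin m)) (μ : E → ℝ)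
    (p v : V → EuclideanSpace ℝ (Fin m)) (μhat : E → ℝ) : ℝ :=
  ∑ k, (μ k - μhat k) ^ 2 + ∑ i, ‖v i‖ ^ 2 + (∑ k, G.distError pstar p k ^ 2) / 2

theorem distError_sq_le (G : SensingGraph V E) (pstar : V → EuclideanSpace ℝ (Fin m)) (μ : E → ℝ)
    (p v : V → EuclideanSpace ℝ (Fin m)) (μhat : E → ℝ) (k : E) :
    G.distError pstar p k ^ 2 ≤ 2 * G.energy pstar μ p v μhat := by
  have h := Finset.single_le_sum (f := fun k => G.distError pstar p k ^ 2)
    (fun _ _ => sq_nonneg _) (Finset.mem_univ k)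
  have h1 : 0 ≤ ∑ k, (μ k - μhat k) ^ 2 := by positivity
  have h2 : 0 ≤ ∑ i, ‖v i‖ ^ 2 := by positivity
  unfold energy
  linarith

theorem norm_velocity_sq_le (G : SensingGraph V E) (pstar : V → EuclideanSpace ℝ (Fin m))
    (μ : E → ℝ) (p v : V → EuclideanSpace ℝ (Fin m)) (μhat : E → ℝ) (i : V) :
    ‖v i‖ ^ 2 ≤ G.energy pstar μ p v μhat := by
  have h := Finset.single_le_sum (f := fun i => ‖v i‖ ^ 2)
    (fun _ _ => sq_nonneg _) (Finset.mem_univ i)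
  have h1 : 0 ≤ ∑ k, (μ k - μhat k) ^ 2 := by positivity
  have h2 : 0 ≤ ∑ k, G.distError pstar p k ^ 2 := by positivity
  unfold energy
  linarith

theorem estimation_error_sq_le (G : SensingGraph V E) (pstar : V → EuclideanSpace ℝ (Fin m))
    (μ : E → ℝ) (p v : V → EuclideanSpace ℝ (Fin m)) (μhat : E → ℝ) (k : E) :
    (μ k - μhat k) ^ 2 ≤ G.energy pstar μ p v μhat := by
  have h := Finset.single_le_sum (f := fun k => (μ k - μhat k) ^ 2)
    (fun _ _ => sq_nonneg _) (Finset.mem_univ k)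
  have h1 : 0 ≤ ∑ i, ‖v i‖ ^ 2 := by positivity
  have h2 : 0 ≤ ∑ k, G.distError pstar p k ^ 2 := by positivity
  unfold energy
  linarith

namespace IsTrajectory

variable {G : SensingGraph V E} {pstar : V → EuclideanSpace ℝ (Fin m)} {μ : E → ℝ}
  {p v : ℝ → V → EuclideanSpace ℝ (Fin m)} {μhat : ℝ → E → ℝ}

theorem hasDerivWithinAt_relPos (h : G.IsTrajectory pstar μ p v μhat) {t : ℝ} (ht : 0 ≤ t)
    (k : E) : HasDerivWithinAt (fun s => G.relPos (p s) k) (G.relPos (v t) k) (Ici 0) t := by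
  unfold relPos
  exact HasDerivWithinAt.fun_sum fun i _ => (h.position t ht i).fun_const_smul _

theorem hasDerivWithinAt_distError (h : G.IsTrajectory pstar μ p v μhat) {t : ℝ} (ht : 0 ≤ t)
    (k : E) : HasDerivWithinAt (fun s => G.distError pstar (p s) k)
      (2 * inner ℝ (G.relPos (p t) k) (G.relPos (v t) k)) (Ici 0) t := by
  unfold distError
  exact (h.hasDerivWithinAt_relPos ht k).norm_sq.sub_const _

/-- Along trajectories the energy is dissipated at the rate `2 ‖v‖²`. -/
theorem hasDerivWithinAt_energy (h : G.IsTrajectory pstar μ p v μhat) {t : ℝ} (ht : 0 ≤ t) :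
    HasDerivWithinAt (fun s => G.energy pstar μ (p s) (v s) (μhat s))
      (-(2 * ∑ i, ‖v t i‖ ^ 2)) (Ici 0) t := by
  have h1 := HasDerivWithinAt.fun_sum (u := Finset.univ) fun k _ =>
    ((h.estimator t ht k).const_sub (μ k)).pow 2
  have h2 := HasDerivWithinAt.fun_sum (u := Finset.univ) fun i _ => (h.velocity t ht i).norm_sq
  have h3 := (HasDerivWithinAt.fun_sum (u := Finset.univ) fun k _ =>
    (h.hasDerivWithinAt_distError ht k).pow 2).div_const 2
  refine ((h1.add h2).add h3).congr_deriv ?_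
  -- Everything is expanded in the products `⟨v_i, z_k⟩`; after exchanging the sums, the error and
  -- estimator terms cancel in pairs.
  have e1 : ∀ k, inner ℝ (G.relPos (p t) k) (∑ i, G.estimating i k • v t i)
      = ∑ i, G.estimating i k * inner ℝ (v t i) (G.relPos (p t) k) := fun k => by
    simp only [inner_sum, real_inner_smul_right, real_inner_comm]
  have e2 : ∀ k, inner ℝ (G.relPos (p t) k) (G.relPos (v t) k)
      = ∑ i, G.incidence i k * inner ℝ (v t i) (G.relPos (p t) k) := fun k => by
    rw [relPos.eq_def G (v t)]
    simp only [inner_sum, real_inner_smul_right, real_inner_comm]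
  have e3 : ∀ i, inner ℝ (v t i) (G.control pstar μ (p t) (v t) (μhat t) i)
      = -‖v t i‖ ^ 2
        - ∑ k, G.distError pstar (p t) k
            * (G.incidence i k * inner ℝ (v t i) (G.relPos (p t) k))
        - ∑ k, (μ k - μhat t k)
            * (G.estimating i k * inner ℝ (v t i) (G.relPos (p t) k)) := fun i => by
    unfold control
    simp only [inner_sub_right, inner_neg_right, inner_sum, real_inner_smul_right,
      real_inner_self_eq_norm_sq]
    congr 1
    · congr 1
      exact Finset.sum_congr rfl fun k _ => by ring
    · exact Finset.sum_congr rfl fun k _ => by ring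
  have e4 : ∀ (c : E → ℝ) (w : V → E → ℝ), ∑ i, ∑ k, c k * w i k = ∑ k, c k * ∑ i, w i k :=
    fun c w => by
      rw [Finset.sum_comm]
      simp only [Finset.mul_sum]
  have s1 : ∀ a b : E → ℝ, ∑ k, (2 : ℕ) * a k ^ (2 - 1) * -(-b k) = 2 * ∑ k, a k * b k :=
    fun a b => by
      rw [Finset.mul_sum]
      exact Finset.sum_congr rfl fun k _ => by norm_num; ring
  have s2 : ∀ a b : E → ℝ, (∑ k, (2 : ℕ) * a k ^ (2 - 1) * (2 * b k)) / 2 = 2 * ∑ k, a k * b k :=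
    fun a b => by
      rw [Finset.mul_sum, Finset.sum_div]
      exact Finset.sum_congr rfl fun k _ => by norm_num; ring
  simp only [estimatorInput, e1, e2, e3, s1, s2]
  rw [← Finset.mul_sum, Finset.sum_sub_distrib, Finset.sum_sub_distrib, e4, e4,
    Finset.sum_neg_distrib]
  ring

theorem antitoneOn_energy (h : G.IsTrajectory pstar μ p v μhat) :
    AntitoneOn (fun t => G.energy pstar μ (p t) (v t) (μhat t)) (Ici 0) := by
  refine antitoneOn_of_hasDerivWithinAt_nonpos (convex_Ici 0)
    (fun t ht => (h.hasDerivWithinAt_energy ht).continuousWithinAt)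
    (fun t ht => (h.hasDerivWithinAt_energy (interior_subset ht)).mono interior_subset)
    fun t _ => ?_
  have : 0 ≤ ∑ i, ‖v t i‖ ^ 2 := by positivity
  linarith

theorem energy_le (h : G.IsTrajectory pstar μ p v μhat) {t : ℝ} (ht : 0 ≤ t) :
    G.energy pstar μ (p t) (v t) (μhat t) ≤ G.energy pstar μ (p 0) (v 0) (μhat 0) :=
  h.antitoneOn_energy self_mem_Ici ht ht

theorem abs_distError_le (h : G.IsTrajectory pstar μ p v μhat) {ρ t : ℝ}
    (h0 : G.InSublevel pstar μ ρ (p 0) (v 0) (μhat 0)) (ht : 0 ≤ t) (k : E) :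
    |G.distError pstar (p t) k| ≤ √(2 * ρ) := by
  refine Real.abs_le_sqrt ((G.distError_sq_le pstar μ (p t) (v t) (μhat t) k).trans ?_)
  have := (h.energy_le ht).trans h0
  linarith

theorem bounded_velocity (h : G.IsTrajectory pstar μ p v μhat) (i : V) :
    BoundedSignal fun t => v t i :=
  ⟨_, fun t ht => Real.le_sqrt_of_sq_le
    ((G.norm_velocity_sq_le pstar μ (p t) (v t) (μhat t) i).trans (h.energy_le ht))⟩

/-- The energy bounds `e_k`, and `‖z_k‖²` differs from it by a constant. -/
theorem bounded_relPos (h : G.IsTrajectory pstar μ p v μhat) (k : E) :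
    BoundedSignal fun t => G.relPos (p t) k := by
  refine ⟨√(√(2 * G.energy pstar μ (p 0) (v 0) (μhat 0)) + ‖G.relPos pstar k‖ ^ 2),
    fun t ht => Real.le_sqrt_of_sq_le ?_⟩
  have := (le_abs_self _).trans (h.abs_distError_le
    (ρ := G.energy pstar μ (p 0) (v 0) (μhat 0)) le_rfl ht k)
  rw [distError] at this
  linarith

theorem tame_relPos (h : G.IsTrajectory pstar μ p v μhat) (k : E) :
    TameSignal fun t => G.relPos (p t) k :=
  (h.bounded_relPos k).tame
    (f' := fun t => G.relPos (v t) k)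
    (BoundedSignal.sum _ fun i => (BoundedSignal.const (G.incidence i k)).smul
      (h.bounded_velocity i))
    fun _ ht => h.hasDerivWithinAt_relPos ht k

theorem tame_distError (h : G.IsTrajectory pstar μ p v μhat) (k : E) :
    TameSignal fun t => G.distError pstar (p t) k :=
  (h.tame_relPos k).norm_sq.sub (.const _)

theorem tame_estimation_error (h : G.IsTrajectory pstar μ p v μhat) (k : E) :
    TameSignal fun t => μ k - μhat t k := by
  refine BoundedSignal.tame (f' := fun t => -G.estimatorInput (p t) (v t) k)
    ⟨_, fun t ht => Real.abs_le_sqrt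
      ((G.estimation_error_sq_le pstar μ (p t) (v t) (μhat t) k).trans (h.energy_le ht))⟩ ?_
    fun t ht => (h.estimator t ht k).const_sub _
  exact ((h.bounded_relPos k).inner (.sum _ fun i =>
    (BoundedSignal.const (G.estimating i k)).smul (h.bounded_velocity i))).neg.neg

/-- The control input other than the damping is a tame signal. -/
theorem tame_control_add_velocity (h : G.IsTrajectory pstar μ p v μhat) (i : V) :
    TameSignal fun t =>
      (∑ k, (G.incidence i k * G.distError pstar (p t) k) • G.relPos (p t) k)
        + ∑ k, (G.estimating i k * (μ k - μhat t k)) • G.relPos (p t) k :=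
  (TameSignal.sum _ fun k => ((TameSignal.const (G.incidence i k)).smul
    (h.tame_distError k)).smul (h.tame_relPos k)).add
  (TameSignal.sum _ fun k => ((TameSignal.const (G.estimating i k)).smul
    (h.tame_estimation_error k)).smul (h.tame_relPos k))

theorem control_eq (t : ℝ) (i : V) :
    G.control pstar μ (p t) (v t) (μhat t) i = -v t i -
      ((∑ k, (G.incidence i k * G.distError pstar (p t) k) • G.relPos (p t) k)
        + ∑ k, (G.estimating i k * (μ k - μhat t k)) • G.relPos (p t) k) := by
  unfold control
  abel

/-- The acceleration is `-v` minus a tame signal, hence bounded because `v` is. -/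
theorem tame_velocity (h : G.IsTrajectory pstar μ p v μhat) (i : V) :
    TameSignal fun t => v t i :=
  (h.bounded_velocity i).tame
    ((h.bounded_velocity i).neg.sub (h.tame_control_add_velocity i).1)
    fun t ht => (h.velocity t ht i).congr_deriv (control_eq t i)

theorem tendsto_velocity (h : G.IsTrajectory pstar μ p v μhat) (i : V) :
    Tendsto (fun t => v t i) atTop (𝓝 0) := by
  have hE : ∃ L, Tendsto (fun t => G.energy pstar μ (p t) (v t) (μhat t)) atTop (𝓝 L) := by
    -- Time is clamped at `0`, since monotonicity is known only on `[0, ∞)`.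
    have hanti : Antitone fun t => G.energy pstar μ (p (max t 0)) (v (max t 0)) (μhat (max t 0)) :=
      fun s t hst => h.antitoneOn_energy (le_max_right s 0) (le_max_right t 0)
        (max_le_max_right 0 hst)
    have hbdd : BddBelow (range fun t =>
        G.energy pstar μ (p (max t 0)) (v (max t 0)) (μhat (max t 0))) := by
      refine ⟨0, ?_⟩
      rintro _ ⟨t, rfl⟩
      exact (sq_nonneg _).trans (G.norm_velocity_sq_le pstar μ _ (v (max t 0)) _ i)
    refine ⟨_, (tendsto_atTop_ciInf hanti hbdd).congr' ?_⟩
    filter_upwards [eventually_ge_atTop (0 : ℝ)] with t ht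
    rw [max_eq_left ht]
  obtain ⟨L, hL⟩ := hE
  have h1 := tendsto_deriv_zero_of_tendsto (fun t ht => h.hasDerivWithinAt_energy ht)
    ((TameSignal.const (2 : ℝ)).smul
      (TameSignal.sum Finset.univ fun i => (h.tame_velocity i).norm_sq)).neg hL
  rw [tendsto_zero_iff_norm_tendsto_zero] at h1 ⊢
  have h2 : Tendsto (fun t => ‖v t i‖ ^ 2) atTop (𝓝 0) := by
    refine squeeze_zero (fun t => sq_nonneg _) (fun t => ?_) h1
    have h3 := Finset.single_le_sum (f := fun i => ‖v t i‖ ^ 2)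
      (fun _ _ => sq_nonneg _) (Finset.mem_univ i)
    rw [norm_neg]
    refine le_trans ?_ (Real.le_norm_self _)
    nlinarith [sq_nonneg ‖v t i‖]
  simpa using h2.sqrt

/-- At an agent that estimates nothing the distance-error forces balance asymptotically. -/
theorem tendsto_force (h : G.IsTrajectory pstar μ p v μhat) {i : V} (hi : ∀ k, G.tail k ≠ i) :
    Tendsto (fun t => ∑ k, (G.incidence i k * G.distError pstar (p t) k) • G.relPos (p t) k)
      atTop (𝓝 0) := by
  -- Barbalat again, now for `v` itself: the acceleration tends to zero.
  have h1 := tendsto_deriv_zero_of_tendsto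
    (fun t ht => (h.velocity t ht i).congr_deriv (control_eq t i))
    ((h.tame_velocity i).neg.sub (h.tame_control_add_velocity i)) (h.tendsto_velocity i)
  have h2 : ∀ k, G.estimating i k = 0 := fun k => if_neg (hi k).symm
  have h3 := (h.tendsto_velocity i).neg.sub h1
  simpa [h2] using h3

end IsTrajectory

end SensingGraph

end Formation

end

noncomputable section

namespace Formation

open Set Filter

/-! ### Gram determinants and recovery of coefficients. -/

section Gram

variable {F : Type*} [NormedAddCommGroup F] [InnerProductSpace ℝ F]

/-- The Gram determinant of two sides of a triangle in terms of the squared lengths of the three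
sides, the last one being the third side. -/
def triangleGram (x y w : ℝ) : ℝ := x * y - ((x + y - w) / 2) ^ 2

/-- Polarization: the third side determines the inner product. -/
theorem triangleGram_norm_sq (a b : F) :
    triangleGram (‖a‖ ^ 2) (‖b‖ ^ 2) (‖a - b‖ ^ 2)
      = ‖a‖ ^ 2 * ‖b‖ ^ 2 - inner ℝ a b ^ 2 := by
  rw [triangleGram, norm_sub_sq_real]
  ring

theorem triangleGram_pos {a b : F}
    (hab : ∀ α β : ℝ, α • a + β • b = 0 → α = 0 ∧ β = 0) :
    0 < triangleGram (‖a‖ ^ 2) (‖b‖ ^ 2) (‖a - b‖ ^ 2) := by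
  rw [triangleGram_norm_sq]
  by_contra! hle
  -- Equality case of Cauchy–Schwarz: a nonpositive determinant kills this vector, whose
  -- `b`-coefficient `-‖a‖²` must then vanish.
  have hn : ‖(inner ℝ a b : ℝ) • a + (-‖a‖ ^ 2) • b‖ ^ 2
      = ‖a‖ ^ 2 * (‖a‖ ^ 2 * ‖b‖ ^ 2 - inner ℝ a b ^ 2) := by
    rw [norm_add_sq_real, norm_smul, norm_smul, real_inner_smul_left, real_inner_smul_right,
      mul_pow, mul_pow, Real.norm_eq_abs, Real.norm_eq_abs, sq_abs, sq_abs]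
    ring
  have hz : ‖(inner ℝ a b : ℝ) • a + (-‖a‖ ^ 2) • b‖ ^ 2 ≤ 0 :=
    hn ▸ mul_nonpos_of_nonneg_of_nonpos (sq_nonneg _) hle
  have h1 := (hab _ _ (norm_eq_zero.1 (pow_eq_zero_iff two_ne_zero |>.1
    (le_antisymm hz (sq_nonneg _))))).2
  have ha : a = 0 := by simpa using h1
  exact one_ne_zero (hab 1 0 (by simp [ha])).1

/-- If a combination of two bounded signals with Gram determinant bounded away from zero vanishes
asymptotically, then so do the coefficients. -/
theorem tendsto_coeff_zero {a b : ℝ → F} {x y : ℝ → ℝ} {c : ℝ} (hc : 0 < c)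
    (ha : BoundedSignal a) (hb : BoundedSignal b)
    (hg : ∀ t, 0 ≤ t → c ≤ ‖a t‖ ^ 2 * ‖b t‖ ^ 2 - inner ℝ (a t) (b t) ^ 2)
    (h : Tendsto (fun t => x t • a t + y t • b t) atTop (𝓝 0)) :
    Tendsto x atTop (𝓝 0) := by
  obtain ⟨A, hA⟩ := ha
  obtain ⟨B, hB⟩ := hb
  have hu : Tendsto (fun t => ‖x t • a t + y t • b t‖ * (2 * A * B ^ 2) / c) atTop (𝓝 0) := by
    simpa using (h.norm.mul_const (2 * A * B ^ 2)).div_const c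
  refine squeeze_zero_norm' ?_ hu
  filter_upwards [eventually_ge_atTop (0 : ℝ)] with t ht
  set u := x t • a t + y t • b t with hu
  -- Cramer's rule: the vector paired with `u` is orthogonal to `b t`, which eliminates `y t`.
  have key : x t * (‖a t‖ ^ 2 * ‖b t‖ ^ 2 - inner ℝ (a t) (b t) ^ 2)
      = inner ℝ u (‖b t‖ ^ 2 • a t - (inner ℝ (a t) (b t) : ℝ) • b t) := by
    simp only [hu, inner_sub_right, inner_add_left, real_inner_smul_left, real_inner_smul_right,
      real_inner_self_eq_norm_sq, real_inner_comm (a t) (b t)]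
    ring
  have hA' := hA t ht
  have hB' := hB t ht
  have hA0 : 0 ≤ A := (norm_nonneg _).trans hA'
  have hw : ‖‖b t‖ ^ 2 • a t - (inner ℝ (a t) (b t) : ℝ) • b t‖ ≤ 2 * A * B ^ 2 := by
    refine (norm_sub_le _ _).trans ?_
    rw [norm_smul, norm_smul, norm_pow, norm_norm]
    have hi : ‖(inner ℝ (a t) (b t) : ℝ)‖ ≤ ‖a t‖ * ‖b t‖ := norm_inner_le_norm _ _
    calc ‖b t‖ ^ 2 * ‖a t‖ + ‖(inner ℝ (a t) (b t) : ℝ)‖ * ‖b t‖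
        ≤ ‖b t‖ ^ 2 * ‖a t‖ + ‖a t‖ * ‖b t‖ * ‖b t‖ := by gcongr
      _ = 2 * ‖a t‖ * ‖b t‖ ^ 2 := by ring
      _ ≤ 2 * A * B ^ 2 := by gcongr
  rw [le_div_iff₀ hc]
  calc ‖x t‖ * c ≤ ‖x t‖ * (‖a t‖ ^ 2 * ‖b t‖ ^ 2 - inner ℝ (a t) (b t) ^ 2) := by
        gcongr
        exact hg t ht
    _ = ‖x t * (‖a t‖ ^ 2 * ‖b t‖ ^ 2 - inner ℝ (a t) (b t) ^ 2)‖ := by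
        rw [norm_mul, Real.norm_of_nonneg (hc.le.trans (hg t ht))]
    _ ≤ ‖u‖ * ‖‖b t‖ ^ 2 • a t - (inner ℝ (a t) (b t) : ℝ) • b t‖ := by
        rw [key]
        exact norm_inner_le_norm _ _
    _ ≤ _ := by gcongr

end Gram

/-! ### Rigidity and the triangles of the graph. -/

theorem SensingGraph.IsInfinitesimallyMinimallyRigid.linearIndependent_rows
    {V E : Type*} [Fintype V] [DecidableEq V] [Fintype E] {m : ℕ} {G : SensingGraph V E}
    {p : V → EuclideanSpace ℝ (Fin m)} (h : G.IsInfinitesimallyMinimallyRigid p) :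
    LinearIndependent ℝ fun (k : E) (ia : V × Fin m) =>
      G.relPos p k ia.2 * G.incidence ia.1 k := by
  change LinearIndependent ℝ (G.rigidityMatrix p).row
  rw [linearIndependent_iff_card_eq_finrank_span, Set.finrank,
    ← Matrix.rank_eq_finrank_span_row]
  -- Minimality makes the number of rows equal to the rank.
  obtain ⟨h1 | h1, h2, h3⟩ := h
  · have := h2 h1.1
    omega
  · have := h3 h1.1
    omega

/-! The graph consists of `N + 1` triangles over the common base `Sum.inl 1`, indexed by
`Option (Fin N)`. -/

/-- The apex of a triangle: agent 1 or a new agent. -/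
def apex (N : ℕ) : Option (Fin N) → StarAgent N
  | none => Sum.inl 0
  | some j => Sum.inr j

/-- The edge from agent 2 to the apex. -/
def leftLeg (N : ℕ) : Option (Fin N) → StarEdge N
  | none => Sum.inl 0
  | some j => Sum.inr (j, 0)

/-- The edge from agent 3 to the apex. -/
def rightLeg (N : ℕ) : Option (Fin N) → StarEdge N
  | none => Sum.inl 2
  | some j => Sum.inr (j, 1)

variable {N m : ℕ}

theorem tail_leftLeg (o : Option (Fin N)) : (starGraph N).tail (leftLeg N o) = Sum.inl 1 := by
  cases o <;> rfl

theorem tail_rightLeg (o : Option (Fin N)) : (starGraph N).tail (rightLeg N o) = Sum.inl 2 := by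
  cases o <;> rfl

theorem head_leftLeg (o : Option (Fin N)) : (starGraph N).head (leftLeg N o) = apex N o := by
  cases o <;> rfl

theorem head_rightLeg (o : Option (Fin N)) : (starGraph N).head (rightLeg N o) = apex N o := by
  cases o <;> rfl

theorem tail_base : (starGraph N).tail (Sum.inl 1) = Sum.inl 1 := rfl

theorem head_base : (starGraph N).head (Sum.inl 1) = Sum.inl 2 := rfl

theorem leftLeg_ne_base (o : Option (Fin N)) : leftLeg N o ≠ Sum.inl 1 := by
  cases o <;> simp [leftLeg]

theorem rightLeg_ne_base (o : Option (Fin N)) : rightLeg N o ≠ Sum.inl 1 := by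
  cases o <;> simp [rightLeg]

theorem leftLeg_ne_rightLeg (o : Option (Fin N)) : leftLeg N o ≠ rightLeg N o := by
  cases o <;> simp [leftLeg, rightLeg]

theorem apex_ne_two (o : Option (Fin N)) : apex N o ≠ Sum.inl 1 := by
  cases o <;> simp [apex]

theorem apex_ne_three (o : Option (Fin N)) : apex N o ≠ Sum.inl 2 := by
  cases o <;> simp [apex]

theorem eq_leg_of_ne_base {k : StarEdge N} (hk : k ≠ Sum.inl 1) :
    ∃ o, k = leftLeg N o ∨ k = rightLeg N o := by
  rcases k with k | ⟨j, a⟩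
  · refine ⟨none, ?_⟩
    fin_cases k <;> simp_all [leftLeg, rightLeg]
  · refine ⟨some j, ?_⟩
    fin_cases a <;> simp [leftLeg, rightLeg]

/-- Only agents 2 and 3 estimate, so no mismatch term acts at an apex. -/
theorem tail_ne_apex (o : Option (Fin N)) (k : StarEdge N) : (starGraph N).tail k ≠ apex N o := by
  rcases k with k | ⟨j, a⟩
  · fin_cases k <;> cases o <;> simp [starGraph, starTail, apex]
  · fin_cases a <;> cases o <;> simp [starGraph, starTail, apex]

theorem eq_leg_of_head_eq_apex {o : Option (Fin N)} {k : StarEdge N}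
    (hk : (starGraph N).head k = apex N o) : k = leftLeg N o ∨ k = rightLeg N o := by
  rcases k with k | ⟨j, a⟩
  · fin_cases k <;> cases o <;> simp_all [starGraph, starHead, apex, leftLeg, rightLeg]
  · fin_cases a <;> cases o <;> simp_all [starGraph, starHead, apex, leftLeg, rightLeg]

theorem relPos_base (p : StarAgent N → EuclideanSpace ℝ (Fin m)) (o : Option (Fin N)) :
    (starGraph N).relPos p (Sum.inl 1)
      = (starGraph N).relPos p (leftLeg N o) - (starGraph N).relPos p (rightLeg N o) := by
  simp only [SensingGraph.relPos_eq_sub, tail_leftLeg, tail_rightLeg, head_leftLeg, head_rightLeg,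
    tail_base, head_base]
  abel

theorem sum_incidence_apex (o : Option (Fin N)) (e : StarEdge N → ℝ)
    (z : StarEdge N → EuclideanSpace ℝ (Fin m)) :
    ∑ k, ((starGraph N).incidence (apex N o) k * e k) • z k
      = -(e (leftLeg N o) • z (leftLeg N o) + e (rightLeg N o) • z (rightLeg N o)) := by
  classical
  rw [← Finset.sum_subset (Finset.subset_univ {leftLeg N o, rightLeg N o}),
    Finset.sum_pair (leftLeg_ne_rightLeg o)]
  · simp [SensingGraph.incidence, (tail_ne_apex o _).symm, head_leftLeg, head_rightLeg]
    abel
  · intro k _ hk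
    have : apex N o ≠ (starGraph N).head k := fun h => hk <| by
      simpa using eq_leg_of_head_eq_apex h.symm
    simp [SensingGraph.incidence, (tail_ne_apex o k).symm, this]

/-- The legs of each triangle of a rigid configuration are linearly independent. -/
theorem legs_independent {p : StarAgent N → EuclideanSpace ℝ (Fin m)}
    (h : (starGraph N).IsInfinitesimallyMinimallyRigid p) (o : Option (Fin N)) (α β : ℝ)
    (hαβ : α • (starGraph N).relPos p (leftLeg N o)
      + β • (starGraph N).relPos p (rightLeg N o) = 0) : α = 0 ∧ β = 0 := by
  have hinj : Function.Injective ![leftLeg N o, rightLeg N o, Sum.inl 1] := by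
    have h1 := leftLeg_ne_base o
    have h2 := rightLeg_ne_base o
    have h3 := leftLeg_ne_rightLeg o
    intro i j hij
    fin_cases i <;> fin_cases j <;> simp_all [eq_comm]
  -- If `α a + β b = 0` for the legs `a`, `b`, these weights on `a`, `b` and the base `a - b` form
  -- an equilibrium stress: the forces at agents 2, 3 and the apex are `α`, `β` and `-(α + β)` times
  -- `α a + β b`.
  have hli := Fintype.linearIndependent_iff.1 (h.linearIndependent_rows.comp _ hinj)
    ![(α + β) * α, (α + β) * β, -(α * β)] ?_
  · have h0 := hli 0
    have h1 := hli 1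
    have h2 := hli 2
    simp only [Matrix.cons_val] at h0 h1 h2
    have hs : α + β = 0 := by
      have : (α + β) ^ 2 = 0 := by linear_combination h0 + h1
      simpa using this
    have hα : α ^ 2 = 0 := by linear_combination h2 + α * hs
    have hα : α = 0 := by simpa using hα
    exact ⟨hα, by linarith⟩
  · ext ⟨i, x⟩
    have hx : α * (starGraph N).relPos p (leftLeg N o) x
        + β * (starGraph N).relPos p (rightLeg N o) x = 0 := by
      simpa using congrArg (fun w => w x) hαβ
    have hb : (starGraph N).relPos p (Sum.inl 1) x = (starGraph N).relPos p (leftLeg N o) x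
        - (starGraph N).relPos p (rightLeg N o) x := by
      rw [relPos_base p o]
      rfl
    have ha2 := apex_ne_two o
    have ha3 := apex_ne_three o
    have h23 : (Sum.inl 1 : StarAgent N) ≠ Sum.inl 2 := by simp
    have hB : (starGraph N).incidence i (Sum.inl 1)
        = if i = Sum.inl 1 then 1 else if i = Sum.inl 2 then -1 else 0 := rfl
    simp only [Fin.sum_univ_three, Function.comp_apply, Matrix.cons_val, Pi.add_apply,
      Pi.smul_apply, smul_eq_mul, hb, hB, Pi.zero_apply]
    simp only [SensingGraph.incidence, tail_leftLeg, tail_rightLeg, head_leftLeg, head_rightLeg]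
    by_cases hi2 : i = Sum.inl 1
    · subst hi2
      simp only [if_true, if_neg h23, if_neg ha2.symm]
      linear_combination α * hx
    by_cases hi3 : i = Sum.inl 2
    · subst hi3
      simp only [if_true, if_neg h23.symm, if_neg ha3.symm]
      linear_combination β * hx
    by_cases hia : i = apex N o
    · simp only [if_neg hi2, if_neg hi3, if_pos hia]
      linear_combination -(α + β) * hx
    · simp only [if_neg hi2, if_neg hi3, if_neg hia]
      ring

/-- The Gram determinant of the legs of the triangle `o` when the distance errors are `e`. -/
def legGram (p : StarAgent N → EuclideanSpace ℝ (Fin m)) (o : Option (Fin N))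
    (e : StarEdge N → ℝ) : ℝ :=
  triangleGram (e (leftLeg N o) + ‖(starGraph N).relPos p (leftLeg N o)‖ ^ 2)
    (e (rightLeg N o) + ‖(starGraph N).relPos p (rightLeg N o)‖ ^ 2)
    (e (Sum.inl 1) + ‖(starGraph N).relPos p (Sum.inl 1)‖ ^ 2)

theorem legGram_zero_pos {p : StarAgent N → EuclideanSpace ℝ (Fin m)}
    (h : (starGraph N).IsInfinitesimallyMinimallyRigid p) (o : Option (Fin N)) :
    0 < legGram p o 0 := by
  simpa [legGram, ← relPos_base p o] using triangleGram_pos (legs_independent h o)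

/-- Adding the desired squared length to the error returns the current one, so bounds on `legGram`
apply to the moving legs. -/
theorem legGram_distError (pstar p : StarAgent N → EuclideanSpace ℝ (Fin m))
    (o : Option (Fin N)) :
    legGram pstar o ((starGraph N).distError pstar p)
      = ‖(starGraph N).relPos p (leftLeg N o)‖ ^ 2 * ‖(starGraph N).relPos p (rightLeg N o)‖ ^ 2
        - inner ℝ ((starGraph N).relPos p (leftLeg N o))
            ((starGraph N).relPos p (rightLeg N o)) ^ 2 := by
  simp only [legGram, SensingGraph.distError, sub_add_cancel, relPos_base p o,
    triangleGram_norm_sq]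

/-- The Gram determinants of the legs are bounded below as long as the distance errors are
small. -/
theorem exists_legGram_lower_bound {p : StarAgent N → EuclideanSpace ℝ (Fin m)}
    (h : (starGraph N).IsInfinitesimallyMinimallyRigid p) :
    ∃ ε > 0, ∀ e : StarEdge N → ℝ, (∀ k, |e k| < ε) →
      ∀ o, legGram p o 0 / 2 ≤ legGram p o e := by
  have hev : ∀ᶠ e in 𝓝 (0 : StarEdge N → ℝ), ∀ o, legGram p o 0 / 2 < legGram p o e := by
    refine eventually_all.2 fun o => ?_
    have hc : Continuous (legGram p o) := by
      unfold legGram triangleGram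
      fun_prop
    exact hc.continuousAt.eventually (lt_mem_nhds (half_lt_self (legGram_zero_pos h o)))
  obtain ⟨ε, hε, hball⟩ := Metric.eventually_nhds_iff.1 hev
  refine ⟨ε, hε, fun e he o => (hball ?_ o).le⟩
  rw [dist_zero_right, pi_norm_lt_iff hε]
  exact he

end Formation

end

theorem proposition1 (N m : ℕ)
    (pstar : Formation.StarAgent N → EuclideanSpace ℝ (Fin m))
    (hrigid : (Formation.starGraph N).IsInfinitesimallyMinimallyRigid pstar) :
    ∃ ρ₀ : ℝ, 0 < ρ₀ ∧ ∀ ρ : ℝ, 0 < ρ → ρ ≤ ρ₀ →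
      ∀ (μ : Formation.StarEdge N → ℝ)
        (p v : ℝ → Formation.StarAgent N → EuclideanSpace ℝ (Fin m))
        (μhat : ℝ → Formation.StarEdge N → ℝ),
        (Formation.starGraph N).IsTrajectory pstar μ p v μhat →
        (Formation.starGraph N).InSublevel pstar μ ρ (p 0) (v 0) (μhat 0) →
        (∀ k : Formation.StarEdge N, k ≠ Sum.inl 1 →
          Filter.Tendsto (fun t => (Formation.starGraph N).distError pstar (p t) k)
            Filter.atTop (𝓝 0)) ∧
        ∀ t : ℝ, 0 ≤ t →
          |(Formation.starGraph N).distError pstar (p t) (Sum.inl 1)| ≤ Real.sqrt (2 * ρ) := by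
  obtain ⟨ε, hε, hgram⟩ := Formation.exists_legGram_lower_bound hrigid
  -- With this `ρ₀`, `√(2ρ) ≤ ε / √2 < ε`, so the errors stay in the range of the Gram bound for all
  -- time.
  refine ⟨ε ^ 2 / 4, by positivity, fun ρ _ hρ μ p v μhat htraj h0 =>
    ⟨fun k hk => ?_, fun t ht => htraj.abs_distError_le h0 ht _⟩⟩
  have hsmall : ∀ t, 0 ≤ t → ∀ k, |(Formation.starGraph N).distError pstar (p t) k| < ε := by
    refine fun t ht k => (htraj.abs_distError_le h0 ht k).trans_lt ?_
    rw [Real.sqrt_lt' hε]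
    nlinarith [sq_pos_of_pos hε]
  obtain ⟨o, ho⟩ := Formation.eq_leg_of_ne_base hk
  have hforce := (htraj.tendsto_force (Formation.tail_ne_apex o)).neg
  simp only [Formation.sum_incidence_apex, neg_neg, neg_zero] at hforce
  have hc := half_pos (Formation.legGram_zero_pos hrigid o)
  have hlow := fun t ht => hgram _ (hsmall t ht) o
  simp only [Formation.legGram_distError] at hlow
  rcases ho with rfl | rfl
  · exact Formation.tendsto_coeff_zero hc (htraj.bounded_relPos _) (htraj.bounded_relPos _)
      hlow hforce
  -- Same argument with the two legs exchanged.
  · refine Formation.tendsto_coeff_zero hc (htraj.bounded_relPos _) (htraj.bounded_relPos _)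
      (fun t ht => ?_) (hforce.congr fun t => add_comm _ _)
    rw [mul_comm, real_inner_comm]
    exact hlow t ht
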